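/- A point $x \in \mathbb{R}^3$ is a multijoint formed by three collections $\mathfrak{L}_1, \mathfrak{L}_2, \mathfrak{L}_3$ of lines in $\mathbb{R}^3$ if for each $i=1,2,3$ there is a line $l_i \in \mathfrak{L}_i$ passing through $x$ such that the directions of $l_1, l_2, l_3$ span $\mathbb{R}^3$. Three collections of lines in $\mathbb{R}^3$ are transversal if, for every choice of one line $l_i$ from the $i$-th collection ($i=1,2,3$), the directions of $l_1, l_2, l_3$ span $\mathbb{R}^3$. For finite collections $\mathfrak{L}_1, \mathfrak{L}_2, \mathfrak{L}_3$ of lines in $\mathbb{R}^3$, let $J_{N_1,N_2,N_3}(\mathfrak{L}_1,\mathfrak{L}_2,\mathfrak{L}_3)$ be the set of those multijoints $x$ formed by them for which there exist transversal collections $\mathfrak{L}_1(x) \subseteq \mathfrak{L}_1$, $\mathfrak{L}_2(x) \subseteq \mathfrak{L}_2$, $\mathfrak{L}_3(x) \subseteq \mathfrak{L}_3$ of lines passing through $x$ with $|\mathfrak{L}_i(x)| \ge N_i$ for all $i=1,2,3$. Theorem. There is an absolute constant $c > 0$ such that, for all finite collections $\mathfrak{L}_1$, $\mathfrak{L}_2$,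 $\mathfrak{L}_3$ of $L_1$, $L_2$ and $L_3$, respectively, lines in $\mathbb{R}^3$, and for all positive integers $N_1, N_2, N_3$, the set $J_{N_1,N_2,N_3}(\mathfrak{L}_1,\mathfrak{L}_2,\mathfrak{L}_3)$ is finite and $$|J_{N_1,N_2,N_3}(\mathfrak{L}_1,\mathfrak{L}_2,\mathfrak{L}_3)| \le c \cdot \frac{(L_1L_2L_3)^{1/2}}{(N_1N_2N_3)^{1/2}}.$$ -/

import Mathlib

namespace Multijoints

/-- A line in `ℝⁿ`: an affine subspace whose direction is one-dimensional.
(The empty affine subspace has zero-dimensional direction, so a line is non-empty.) -/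
def IsLine {n : ℕ} (l : AffineSubspace ℝ (EuclideanSpace ℝ (Fin n))) : Prop :=
  Module.finrank ℝ l.direction = 1

/-- The directions of the lines `l₁, …, lₙ` span `ℝⁿ`. -/
def DirectionsSpan {n : ℕ} (l : Fin n → AffineSubspace ℝ (EuclideanSpace ℝ (Fin n))) : Prop :=
  (⨆ i, (l i).direction) = ⊤

/-- The set `J(𝔏₁, …, 𝔏ₙ)` of multijoints formed by `n` finite collections of lines in `ℝⁿ`. -/
def multijoints {n : ℕ} (𝔏 : Fin n → Finset (AffineSubspace ℝ (EuclideanSpace ℝ (Fin n)))) :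
    Set (EuclideanSpace ℝ (Fin n)) :=
  {x | ∃ l : Fin n → AffineSubspace ℝ (EuclideanSpace ℝ (Fin n)),
    (∀ i, l i ∈ 𝔏 i ∧ x ∈ l i) ∧ DirectionsSpan l}

/-- The collections `𝔏₁, …, 𝔏ₙ` are transversal: any choice of one line from each of them
has spanning directions. -/
def Transversal {n : ℕ}
    (𝔏 : Fin n → Finset (AffineSubspace ℝ (EuclideanSpace ℝ (Fin n)))) : Prop :=
  ∀ l : Fin n → AffineSubspace ℝ (EuclideanSpace ℝ (Fin n)), (∀ i, l i ∈ 𝔏 i) → DirectionsSpan l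

/-- The set `J_{N₁,…,Nₙ}(𝔏₁, …, 𝔏ₙ)` of those multijoints `x` through which there pass transversal
subcollections `𝔏ᵢ(x) ⊆ 𝔏ᵢ`, all of whose lines contain `x`, with `|𝔏ᵢ(x)| ≥ Nᵢ` for every `i`. -/
def richMultijoints {n : ℕ} (N : Fin n → ℝ)
    (𝔏 : Fin n → Finset (AffineSubspace ℝ (EuclideanSpace ℝ (Fin n)))) :
    Set (EuclideanSpace ℝ (Fin n)) :=
  {x | x ∈ multijoints 𝔏 ∧
    ∃ 𝔏x : Fin n → Finset (AffineSubspace ℝ (EuclideanSpace ℝ (Fin n))),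
      (∀ i, 𝔏x i ⊆ 𝔏 i) ∧ (∀ i, ∀ l ∈ 𝔏x i, x ∈ l) ∧ Transversal 𝔏x ∧
        ∀ i, N i ≤ ((𝔏x i).card : ℝ)}

end Multijoints

/-! The proof combines a pruning argument with the polynomial method. Let `S` be a finite set of
rich multijoints. Deleting poor lines leaves a nonempty `A ⊆ S` such that each point of `A` keeps
one of its lines in every class `i`, and that line carries at least `t i = |S| N i / (4 L i)` points
of `A` (`Finset.exists_rich_subset`). By transversality the kept lines span, whichever they are.

For such a set, `∏ t i ≤ (2n)^n |A|` (`prod_le_card`). Take a nonzero polynomial of degree at most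
`d = |A|` in each variable. Let `m` be the largest order to which it vanishes on all of `A`, and
pick `x ∈ A` where order `m + 1` fails. In the frame of the lines at `x` some term of degree `m`
survives, with exponents `a`. Restricting to the `i`-th line bounds `a i` by about `n d / t i`
(`mul_card_le_of_mem_pointIdeal_pow`). So the coefficients with exponents that small, taken in the
frames at all points of `A`, determine the polynomial. Comparing dimensions gives the bound; with `n
= 3` and `|A| ≤ |S|`, one factor `|S|` cancels. -/

namespace MvPolynomial

/-! ### Order of vanishing at a point, as powers of an ideal -/

section CommRing

variable {σ R : Type*} [CommRing R]

/-- The ideal of polynomials vanishing at the point `x`, given by its linear generators. -/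
noncomputable def pointIdeal (x : σ → R) : Ideal (MvPolynomial σ R) :=
  Ideal.span (Set.range fun j => X j - C (x j))

theorem sub_C_eval_mem_pointIdeal (x : σ → R) (P : MvPolynomial σ R) :
    P - C (eval x P) ∈ pointIdeal x := by
  induction P using MvPolynomial.induction_on with
  | C a => simp
  | add p q hp hq =>
    have := add_mem hp hq
    rw [map_add, map_add]
    convert this using 1
    ring
  | mul_X p i hp =>
    have h1 : (X i - C (x i) : MvPolynomial σ R) ∈ pointIdeal x :=
      Ideal.subset_span ⟨i, rfl⟩
    have := add_mem (Ideal.mul_mem_left _ p h1) (Ideal.mul_mem_left _ (C (x i)) hp)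
    rw [map_mul, eval_X, map_mul]
    convert this using 1
    ring

theorem pointIdeal_zero : pointIdeal (0 : σ → R) = idealOfVars σ R := by
  simp [pointIdeal, idealOfVars]

theorem totalDegree_aeval_le_of_totalDegree_le_one (f : σ → MvPolynomial σ R)
    (hf : ∀ i, (f i).totalDegree ≤ 1) (P : MvPolynomial σ R) :
    (aeval f P).totalDegree ≤ P.totalDegree := by
  rw [aeval_def, eval₂_eq]
  refine totalDegree_finsetSum_le fun d hd => ?_
  refine (totalDegree_mul _ _).trans ?_
  rw [algebraMap_eq, totalDegree_C, zero_add]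
  refine (totalDegree_finsetProd _ _).trans (le_trans ?_ (le_totalDegree hd))
  refine Finset.sum_le_sum fun i _ => (totalDegree_pow _ _).trans ?_
  simpa using Nat.mul_le_mul_left (d i) (hf i)

end CommRing

/-! ### Affine changes of coordinates -/

section CompAffine

variable {σ K : Type*} [Fintype σ] [DecidableEq σ] [Field K]

/-- Substitution of an affine map into a polynomial. -/
noncomputable def compAffine (T : (σ → K) →ᵃ[K] (σ → K)) :
    MvPolynomial σ K →ₐ[K] MvPolynomial σ K :=
  aeval fun j => C (T 0 j) + ∑ i, C (T.linear (Pi.single i 1) j) * X i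

theorem eval_compAffine (T : (σ → K) →ᵃ[K] (σ → K)) (y : σ → K) (P : MvPolynomial σ K) :
    eval y (compAffine T P) = eval (T y) P := by
  have key : ∀ j, T y j = T 0 j + ∑ i, T.linear (Pi.single i 1) j * y i := by
    intro j
    have h1 : T y = T.linear y + T 0 := by
      have := T.map_vadd 0 y
      simpa using this
    have h2 : y = ∑ i, y i • (Pi.single i 1 : σ → K) := by
      ext k; simp [Finset.sum_apply, Pi.single_apply]
    have h3 : T.linear y j = ∑ i, T.linear (Pi.single i 1) j * y i := by
      conv_lhs => rw [h2]
      simp [map_sum, Finset.sum_apply, mul_comm]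
    rw [h1, Pi.add_apply, h3, add_comm]
  induction P using MvPolynomial.induction_on with
  | C a => simp [compAffine]
  | add p q hp hq => simp [hp, hq]
  | mul_X p i hp =>
    rw [map_mul, map_mul, hp, map_mul, eval_X, key i]
    simp [compAffine]

theorem compAffine_mem_pointIdeal_pow (T : (σ → K) →ᵃ[K] (σ → K)) (y : σ → K) (m : ℕ)
    {P : MvPolynomial σ K} (hP : P ∈ pointIdeal (T y) ^ m) :
    compAffine T P ∈ pointIdeal y ^ m := by
  have h1 : (pointIdeal (T y)).map (compAffine T) ≤ pointIdeal y := by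
    rw [pointIdeal, Ideal.map_span, Ideal.span_le]
    rintro _ ⟨_, ⟨j, rfl⟩, rfl⟩
    have := sub_C_eval_mem_pointIdeal y (compAffine T (X j))
    rw [eval_compAffine, eval_X] at this
    simpa using this
  have h2 := Ideal.mem_map_of_mem (compAffine T) hP
  rw [Ideal.map_pow] at h2
  exact Ideal.pow_right_mono h1 m h2

theorem compAffine_symm_compAffine [Infinite K] (T : (σ → K) ≃ᵃ[K] (σ → K))
    (P : MvPolynomial σ K) :
    compAffine T.symm.toAffineMap (compAffine T.toAffineMap P) = P := by
  apply funext
  intro y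
  simp [eval_compAffine]

theorem totalDegree_compAffine_le (T : (σ → K) →ᵃ[K] (σ → K)) (P : MvPolynomial σ K) :
    (compAffine T P).totalDegree ≤ P.totalDegree := by
  refine totalDegree_aeval_le_of_totalDegree_le_one _ (fun j => ?_) P
  refine (totalDegree_add _ _).trans (max_le (by simp) ?_)
  refine totalDegree_finsetSum_le fun i _ => ?_
  refine (totalDegree_mul _ _).trans ?_
  simp

end CompAffine

/-! ### Vanishing along a coordinate axis -/

section Slice

variable {σ R : Type*} [CommRing R]

/-- The polynomials whose coefficient at each exponent `b` is divisible by `u ^ (m - |b|)`. -/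
def weightedDvdIdeal (σ : Type*) {R : Type*} [CommRing R] (u : R) (m : ℕ) :
    Ideal (MvPolynomial σ R) where
  carrier := {F | ∀ b : σ →₀ ℕ, u ^ (m - b.degree) ∣ coeff b F}
  add_mem' hF hG b := by
    rw [coeff_add]; exact dvd_add (hF b) (hG b)
  zero_mem' b := by simp
  smul_mem' P F hF b := by
    classical
    rw [smul_eq_mul, coeff_mul]
    refine Finset.dvd_sum fun x hx => Dvd.dvd.mul_left ((pow_dvd_pow u ?_).trans (hF x.2)) _
    rw [Finset.HasAntidiagonal.mem_antidiagonal] at hx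
    rw [← hx, map_add]
    omega

theorem mem_weightedDvdIdeal {u : R} {m : ℕ} {F : MvPolynomial σ R} :
    F ∈ weightedDvdIdeal σ u m ↔ ∀ b : σ →₀ ℕ, u ^ (m - b.degree) ∣ coeff b F := Iff.rfl

/-- In a product of `m` generators, the exponent `b` takes up `|b|` factors `X j`; the remaining `m
- |b|` factors are `u`. -/
theorem span_pow_le_weightedDvdIdeal (u : R) (m : ℕ) :
    (Ideal.span (insert (C u) (Set.range X)) : Ideal (MvPolynomial σ R)) ^ m ≤
      weightedDvdIdeal σ u m := by
  classical
  induction m with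
  | zero => intro F _; rw [mem_weightedDvdIdeal]; simp
  | succ m ih =>
    rw [pow_succ', Ideal.mul_le]
    intro G hG H hH
    replace hH := ih hH
    induction hG using Submodule.span_induction with
    | mem G hG =>
      rw [mem_weightedDvdIdeal] at hH ⊢
      rcases hG with rfl | ⟨j, rfl⟩
      · intro b
        rw [coeff_C_mul]
        refine (pow_dvd_pow u (show m + 1 - b.degree ≤ 1 + (m - b.degree) by omega)).trans ?_
        rw [pow_add, pow_one]
        exact mul_dvd_mul_left u (hH b)
      · intro b
        rw [coeff_X_mul']
        split_ifs with hb
        · refine (pow_dvd_pow u ?_).trans (hH _)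
          have h1 : b = (b - Finsupp.single j 1) + Finsupp.single j 1 := by
            rw [tsub_add_cancel_of_le]
            rw [Finsupp.single_le_iff]
            exact Nat.one_le_iff_ne_zero.2 (Finsupp.mem_support_iff.1 hb)
          have h2 := congrArg Finsupp.degree h1
          rw [map_add, Finsupp.degree_single] at h2
          omega
        · exact dvd_zero _
    | zero => simp
    | add x y _ _ hx hy => rw [add_mul]; exact add_mem hx hy
    | smul a x _ hx => rw [smul_mul_assoc]; exact Submodule.smul_mem _ a hx

variable {K : Type*} [Field K] [DecidableEq σ]

/-- Regard the variable `i` as a coefficient variable. -/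
noncomputable def sliceHom (i : σ) : MvPolynomial σ K →ₐ[K] MvPolynomial σ (Polynomial K) :=
  aeval (Function.update X i (C Polynomial.X))

theorem sliceHom_monomial (i : σ) (a : σ →₀ ℕ) (c : K) :
    sliceHom i (monomial a c) = monomial (a.erase i) (Polynomial.monomial (a i) c) := by
  rw [sliceHom, aeval_monomial, ← Finsupp.mul_prod_erase' a i]
  · rw [Function.update_self]
    have h : ((a.erase i).prod fun j k =>
        (Function.update X i (C Polynomial.X) : σ → MvPolynomial σ (Polynomial K)) j ^ k)
          = (a.erase i).prod fun j k => X j ^ k := by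
      refine Finsupp.prod_congr fun j hj => ?_
      rw [Function.update_of_ne]
      rintro rfl
      simp at hj
    rw [h, monomial_eq, ← Polynomial.C_mul_X_pow_eq_monomial, map_mul, map_pow, ← mul_assoc]
    congr 2
  · simp

/-- The outer variable `X i` no longer occurs after slicing, hence the condition `b i = 0`. -/
theorem coeff_coeff_sliceHom (i : σ) (b : σ →₀ ℕ) (hb : b i = 0) (k : ℕ) (Q : MvPolynomial σ K) :
    (coeff b (sliceHom i Q)).coeff k = coeff (b + Finsupp.single i k) Q := by
  induction Q using MvPolynomial.induction_on' with
  | add p q hp hq => simp [hp, hq]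
  | monomial a c =>
    rw [sliceHom_monomial, coeff_monomial, coeff_monomial]
    have h : a = b + Finsupp.single i k ↔ a.erase i = b ∧ a i = k := by
      constructor
      · rintro rfl
        refine ⟨?_, by simp [hb]⟩
        ext j
        by_cases hj : j = i
        · subst hj; simp [hb]
        · simp [Finsupp.erase_ne hj]
      · rintro ⟨rfl, rfl⟩
        rw [add_comm, Finsupp.single_add_erase]
    by_cases h1 : a.erase i = b <;> by_cases h2 : a i = k <;>
      simp [h, h1, h2, Polynomial.coeff_monomial]

theorem sliceHom_mem (i : σ) (s : K) (m : ℕ) {Q : MvPolynomial σ K}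
    (hQ : Q ∈ pointIdeal (Pi.single i s) ^ m) :
    sliceHom i Q ∈
      (Ideal.span (insert (C (Polynomial.X - Polynomial.C s)) (Set.range X)) :
        Ideal (MvPolynomial σ (Polynomial K))) ^ m := by
  have h2 := Ideal.mem_map_of_mem (sliceHom i) hQ
  rw [Ideal.map_pow] at h2
  refine Ideal.pow_right_mono ?_ m h2
  rw [pointIdeal, Ideal.map_span, Ideal.span_le]
  rintro _ ⟨_, ⟨j, rfl⟩, rfl⟩
  apply Ideal.subset_span
  by_cases hj : j = i
  · subst hj
    left
    simp [sliceHom, MvPolynomial.algebraMap_apply]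
  · right
    exact ⟨j, by simp [sliceHom, hj]⟩

/-- A polynomial of degree at most `n` vanishing to order `m` at many points of a coordinate axis
has no term of degree `m` with a large exponent along that axis. -/
theorem mul_card_le_of_mem_pointIdeal_pow (i : σ) (S : Finset K) {m n : ℕ}
    {Q : MvPolynomial σ K} (hn : Q.totalDegree ≤ n)
    (hQ : ∀ s ∈ S, Q ∈ pointIdeal (Pi.single i s) ^ m) {a : σ →₀ ℕ} (ha : a.degree = m)
    (hc : coeff a Q ≠ 0) : a i * S.card ≤ n := by
  set b := a.erase i with hb
  have hbi : b i = 0 := by simp [hb]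
  have hab : b + Finsupp.single i (a i) = a := by
    rw [add_comm, hb, Finsupp.single_add_erase]
  have hdeg : b.degree + a i = m := by
    rw [← ha, ← hab, map_add, Finsupp.degree_single]; simp [hbi]
  -- `g` is a univariate polynomial along the axis. Since `m - |b| = a i`, it has a zero of order at
  -- least `a i` at every `s ∈ S`, while its degree is at most `n`.
  set g := coeff b (sliceHom i Q) with hg
  have hg0 : g ≠ 0 := by
    intro h
    apply hc
    rw [← hab, ← coeff_coeff_sliceHom i b hbi, ← hg, h, Polynomial.coeff_zero]
  have hdvd : ∀ s ∈ S, (Polynomial.X - Polynomial.C s) ^ (a i) ∣ g := by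
    intro s hs
    have := mem_weightedDvdIdeal.1
      (span_pow_le_weightedDvdIdeal _ _ (sliceHom_mem i s m (hQ s hs))) b
    rwa [show m - b.degree = a i by omega] at this
  have hprod : (∏ s ∈ S, (Polynomial.X - Polynomial.C s) ^ (a i)) ∣ g := by
    refine Finset.prod_dvd_of_coprime (fun s _ t _ hst => ?_) hdvd
    exact (Polynomial.isCoprime_X_sub_C_of_isUnit_sub
      (sub_ne_zero.2 hst).isUnit).pow
  have h1 := Polynomial.natDegree_le_of_dvd hprod hg0
  rw [Polynomial.natDegree_prod_of_monic _ _
    (fun s _ => (Polynomial.monic_X_sub_C s).pow _)] at h1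
  simp only [Polynomial.natDegree_pow, Polynomial.natDegree_X_sub_C, mul_one, Finset.sum_const,
    smul_eq_mul] at h1
  have h2 : g.natDegree ≤ n := by
    refine Polynomial.natDegree_le_iff_coeff_eq_zero.2 fun k hk => ?_
    rw [hg, coeff_coeff_sliceHom i b hbi]
    apply coeff_eq_zero_of_totalDegree_lt
    have : (b + Finsupp.single i k).degree = b.degree + k := by
      rw [map_add, Finsupp.degree_single]
    rw [Finsupp.degree_apply] at this
    omega
  rw [mul_comm]
  omega

end Slice

end MvPolynomial

/-! ### The polynomial method: parameter counting -/

namespace MvPolynomial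

variable {σ K : Type*} [Fintype σ] [DecidableEq σ] [Field K] [Infinite K]

theorem eq_zero_of_mem_pointIdeal_pow (T : (σ → K) ≃ᵃ[K] (σ → K)) {n : ℕ} {P : MvPolynomial σ K}
    (hn : P.totalDegree ≤ n) (hP : P ∈ pointIdeal (T 0) ^ (n + 1)) : P = 0 := by
  have h := compAffine_mem_pointIdeal_pow T.toAffineMap 0 (n + 1) hP
  rw [pointIdeal_zero, mem_pow_idealOfVars_iff'] at h
  have h0 : compAffine T.toAffineMap P = 0 := by
    ext a
    rw [coeff_zero]
    by_cases ha : a.degree < n + 1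
    · exact h a ha
    · apply coeff_eq_zero_of_totalDegree_lt
      have := totalDegree_compAffine_le T.toAffineMap P
      rw [Finsupp.degree_apply] at ha
      omega
  rw [← compAffine_symm_compAffine T P, h0, map_zero]

/-- Let every coordinate axis of the frame `T x` at each `x ∈ A` contain many points of `A`. Then a
nonzero polynomial of degree at most `n` has, in one of these frames, a nonzero coefficient whose
exponents are bounded by `β`. -/
theorem exists_coeff_compAffine_ne_zero {A : Finset (σ → K)} (hA : A.Nonempty)
    (T : (σ → K) → (σ → K) ≃ᵃ[K] (σ → K)) (hT : ∀ x, T x 0 = x)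
    (S : (σ → K) → σ → Finset K)
    (hS : ∀ x ∈ A, ∀ i, ∀ s ∈ S x i, T x (Pi.single i s) ∈ A)
    {β : σ → ℕ} {n : ℕ} (hβ : ∀ x ∈ A, ∀ i, n < (β i + 1) * (S x i).card)
    {P : MvPolynomial σ K} (hP : P ≠ 0) (hn : P.totalDegree ≤ n) :
    ∃ x ∈ A, ∃ a : σ →₀ ℕ, coeff a (compAffine (T x).toAffineMap P) ≠ 0 ∧ ∀ i, a i ≤ β i := by
  classical
  -- The least order that fails somewhere on `A` is written `m + 1`. At the failing point, `P` has
  -- in its frame no term of degree below `m`, but some term of degree exactly `m`.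
  have hex : ∃ m, ∃ x ∈ A, P ∉ pointIdeal x ^ m := by
    obtain ⟨x, hx⟩ := hA
    refine ⟨n + 1, x, hx, fun h => hP ?_⟩
    rw [← hT x] at h
    exact eq_zero_of_mem_pointIdeal_pow (T x) hn h
  obtain ⟨m, hm⟩ : ∃ m, Nat.find hex = m + 1 := by
    refine Nat.exists_eq_succ_of_ne_zero fun h0 => ?_
    obtain ⟨x, -, hx⟩ := Nat.find_spec hex
    rw [h0] at hx
    simp at hx
  have hvan : ∀ q ∈ A, P ∈ pointIdeal q ^ m := by
    intro q hq
    by_contra h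
    exact Nat.find_min hex (m := m) (by omega) ⟨q, hq, h⟩
  obtain ⟨x, hx, hxm⟩ := Nat.find_spec hex
  rw [hm] at hxm
  refine ⟨x, hx, ?_⟩
  set Q := compAffine (T x).toAffineMap P with hQ
  have hQm : Q ∉ idealOfVars σ K ^ (m + 1) := by
    intro h
    apply hxm
    rw [← compAffine_symm_compAffine (T x) P]
    apply compAffine_mem_pointIdeal_pow
    have : (T x).symm.toAffineMap x = 0 := by
      simpa using (T x).symm_apply_eq.2 (hT x).symm
    rwa [this, pointIdeal_zero]
  have hQm' : Q ∈ idealOfVars σ K ^ m := by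
    rw [← pointIdeal_zero]
    apply compAffine_mem_pointIdeal_pow
    simpa [hT x] using hvan x hx
  rw [mem_pow_idealOfVars_iff'] at hQm hQm'
  push Not at hQm
  obtain ⟨a, ha, hc⟩ := hQm
  have hdeg : a.degree = m := by
    by_contra h
    exact hc (hQm' a (by omega))
  refine ⟨a, hc, fun i => ?_⟩
  have h1 := mul_card_le_of_mem_pointIdeal_pow i (S x i)
    ((totalDegree_compAffine_le _ P).trans hn)
    (fun s hs => compAffine_mem_pointIdeal_pow (T x).toAffineMap _ m (hvan _ (hS x hx i s hs)))
    hdeg hc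
  have h2 := lt_of_le_of_lt h1 (hβ x hx i)
  exact Nat.lt_succ_iff.1 (lt_of_mul_lt_mul_right h2 (Nat.zero_le _))

/-- The polynomial with coefficients `v` at the exponents bounded by `d` in each variable. -/
noncomputable def ofBoxCoeffs (d : ℕ) : ((σ → Fin (d + 1)) → K) →ₗ[K] MvPolynomial σ K where
  toFun v := ∑ f, monomial (Finsupp.equivFunOnFinite.symm fun i => (f i : ℕ)) (v f)
  map_add' v w := by simp [Finset.sum_add_distrib]
  map_smul' c v := by simp [Finset.smul_sum, smul_monomial]

omit [Infinite K] in
theorem ofBoxCoeffs_injective (d : ℕ) :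
    Function.Injective (ofBoxCoeffs d : ((σ → Fin (d + 1)) → K) →ₗ[K] MvPolynomial σ K) := by
  classical
  refine (injective_iff_map_eq_zero _).2 fun v hv => ?_
  ext g
  have h := congrArg (coeff (Finsupp.equivFunOnFinite.symm fun i => (g i : ℕ))) hv
  simp only [ofBoxCoeffs, LinearMap.coe_mk, AddHom.coe_mk, coeff_sum, coeff_monomial,
    coeff_zero] at h
  rw [Finset.sum_eq_single g] at h
  · simpa using h
  · intro f _ hfg
    rw [if_neg]
    intro he
    apply hfg
    ext i
    exact congrFun (Finsupp.equivFunOnFinite.symm.injective he) i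
  · simp

omit [Infinite K] in
theorem totalDegree_ofBoxCoeffs_le (d : ℕ) (v : (σ → Fin (d + 1)) → K) :
    (ofBoxCoeffs d v).totalDegree ≤ Fintype.card σ * d := by
  refine totalDegree_finsetSum_le fun f _ => (totalDegree_monomial_le _ _).trans ?_
  rw [Finsupp.sum_fintype _ _ (fun _ => rfl)]
  refine (Finset.sum_le_card_nsmul Finset.univ _ d fun i _ => ?_).trans (by simp)
  simpa using Nat.lt_succ_iff.1 (f i).2

/-- The left side is the dimension of the space of polynomials of degree at most `d` in each
variable. The right side counts the small-exponent coefficients over all frames, and reading these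
off is injective. -/
theorem pow_le_card_mul_prod {A : Finset (σ → K)} (hA : A.Nonempty)
    (T : (σ → K) → (σ → K) ≃ᵃ[K] (σ → K)) (hT : ∀ x, T x 0 = x)
    (S : (σ → K) → σ → Finset K)
    (hS : ∀ x ∈ A, ∀ i, ∀ s ∈ S x i, T x (Pi.single i s) ∈ A)
    {β : σ → ℕ} {d : ℕ}
    (hβ : ∀ x ∈ A, ∀ i, Fintype.card σ * d < (β i + 1) * (S x i).card) :
    (d + 1) ^ Fintype.card σ ≤ A.card * ∏ i, (β i + 1) := by
  let Φ : ((σ → Fin (d + 1)) → K) →ₗ[K] (A × (∀ i, Fin (β i + 1)) → K) :=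
    (LinearMap.pi fun z => lcoeff K (Finsupp.equivFunOnFinite.symm fun i => (z.2 i : ℕ)) ∘ₗ
      (compAffine (T z.1).toAffineMap).toLinearMap) ∘ₗ ofBoxCoeffs d
  have hΦ : Function.Injective Φ := by
    refine (injective_iff_map_eq_zero _).2 fun v hv => ?_
    by_contra hv0
    have hP : ofBoxCoeffs d v ≠ 0 := fun h => hv0 (ofBoxCoeffs_injective d (by simpa using h))
    obtain ⟨x, hx, a, ha, hle⟩ := exists_coeff_compAffine_ne_zero hA T hT S hS hβ hP
      (totalDegree_ofBoxCoeffs_le d v)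
    apply ha
    have := congrFun hv (⟨x, hx⟩, fun i => ⟨a i, Nat.lt_succ_iff.2 (hle i)⟩)
    have ha' : (Finsupp.equivFunOnFinite.symm fun i => a i) = a := by ext; simp
    simpa [Φ, ha'] using this
  have h := LinearMap.finrank_le_finrank_of_injective hΦ
  simpa [Module.finrank_fintype_fun_eq_card] using h

end MvPolynomial

/-! ### Pruning poor lines by minimising an energy -/

/-- Every incidence structure in which each point of `S` lies on at least `N i` elements of each
class `L i` has a substructure whose remaining elements are all rich. -/
theorem Finset.exists_rich_subset {α β ι : Type*} [Fintype ι] {S : Finset α}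
    {Lx : α → ι → Finset β} {L : ι → Finset β} (hL : ∀ x ∈ S, ∀ i, Lx x i ⊆ L i)
    {N c : ι → ℝ} (hN : ∀ i, 0 < N i) (hNL : ∀ x ∈ S, ∀ i, N i ≤ (Lx x i).card)
    (hc0 : ∀ i, 0 ≤ c i) (hc : ∑ i, c i * (L i).card < S.card) :
    ∃ A ⊆ S, A.Nonempty ∧ ∃ l : α → ι → β, ∀ x ∈ A, ∀ i, l x i ∈ Lx x i ∧
      ∃ B ⊆ A, c i * N i ≤ B.card ∧ ∀ q ∈ B, l x i ∈ Lx q i := by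
  classical
  -- The cost of a point grows with the fraction of its lines deleted. The cap 1 is reached once a
  -- whole class is lost, so dead points cost nothing further.
  let w : (ι → Finset β) → α → ℝ := fun R x => min 1 (∑ j, ((Lx x j \ R j).card : ℝ) / N j)
  let F : (ι → Finset β) → ℝ := fun R => ∑ x ∈ S, w R x + ∑ j, c j * (R j).card
  obtain ⟨R, hR, hmin⟩ := Finset.exists_min_image (Fintype.piFinset fun i => (L i).powerset) F
    ⟨L, by simp⟩
  have hRL : ∀ i, R i ⊆ L i := by simpa using hR
  let A := S.filter fun x => ∀ i, (Lx x i ∩ R i).Nonempty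
  have hdead : ∀ x ∈ S, x ∉ A → w R x = 1 := by
    intro x hx hxA
    obtain ⟨i, hi⟩ : ∃ i, Lx x i ∩ R i = ∅ := by
      by_contra! h
      exact hxA (Finset.mem_filter.2 ⟨hx, h⟩)
    refine min_eq_left ?_
    have h1 : (1 : ℝ) ≤ ((Lx x i \ R i).card : ℝ) / N i := by
      rw [one_le_div (hN i),
        Finset.sdiff_eq_self_of_disjoint (Finset.disjoint_iff_inter_eq_empty.2 hi)]
      exact hNL x hx i
    exact h1.trans (Finset.single_le_sum (f := fun j => ((Lx x j \ R j).card : ℝ) / N j)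
      (fun j _ => div_nonneg (Nat.cast_nonneg _) (hN j).le) (Finset.mem_univ i))
  have hFL : F R < S.card := by
    refine lt_of_le_of_lt (hmin L (by simp)) (lt_of_eq_of_lt ?_ hc)
    simp only [F, w]
    rw [Finset.sum_eq_zero, zero_add]
    intro x hx
    rw [Finset.sum_eq_zero]
    · simp
    · intro j _
      simp [Finset.sdiff_eq_empty_iff_subset.2 (hL x hx j)]
  -- Deleting `l` from the minimiser saves `c i` and costs at most `1 / N i` for each live point on
  -- `l`.
  have hrich : ∀ i, ∀ l ∈ R i, c i * N i ≤ ((A.filter fun q => l ∈ Lx q i).card : ℝ) := by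
    intro i l hl
    let R' := Function.update R i ((R i).erase l)
    have hR' : R' ∈ Fintype.piFinset fun i => (L i).powerset := by
      rw [Fintype.mem_piFinset]
      intro j
      rw [Finset.mem_powerset]
      by_cases hj : j = i
      · subst hj
        simpa [R'] using (Finset.erase_subset _ _).trans (hRL j)
      · simpa [R', hj] using hRL j
    have h1 : ∑ j, c j * ((R j).card : ℝ) = ∑ j, c j * ((R' j).card : ℝ) + c i := by
      rw [← Finset.add_sum_erase _ _ (Finset.mem_univ i),
        ← Finset.add_sum_erase _ (fun j => c j * ((R' j).card : ℝ)) (Finset.mem_univ i)]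
      have h2 : ∑ j ∈ Finset.univ.erase i, c j * ((R' j).card : ℝ) =
          ∑ j ∈ Finset.univ.erase i, c j * ((R j).card : ℝ) := by
        refine Finset.sum_congr rfl fun j hj => ?_
        simp [R', Finset.ne_of_mem_erase hj]
      have h3 : ((R i).card : ℝ) = (R' i).card + 1 := by
        simp only [R', Function.update_self]
        exact_mod_cast (Finset.card_erase_add_one hl).symm
      rw [h2, h3]
      ring
    have h4 : ∀ x ∈ S, w R' x ≤ w R x + if x ∈ A ∧ l ∈ Lx x i then 1 / N i else 0 := by
      intro x hx
      by_cases hxA : x ∈ A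
      · have h5 : ∑ j, ((Lx x j \ R' j).card : ℝ) / N j ≤
            ∑ j, ((Lx x j \ R j).card : ℝ) / N j + if l ∈ Lx x i then 1 / N i else 0 := by
          have h6 : (if l ∈ Lx x i then 1 / N i else 0) =
              ∑ j, if j = i then (if l ∈ Lx x i then 1 / N i else 0) else 0 := by simp
          rw [h6, ← Finset.sum_add_distrib]
          refine Finset.sum_le_sum fun j _ => ?_
          by_cases hj : j = i
          · subst hj
            simp only [R', Function.update_self, if_true]
            split_ifs with hlx
            · rw [← add_div]
              refine div_le_div_of_nonneg_right ?_ (hN j).le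
              have : Lx x j \ (R j).erase l ⊆ insert l (Lx x j \ R j) := by
                intro m; simp only [Finset.mem_sdiff, Finset.mem_erase, Finset.mem_insert]; tauto
              exact_mod_cast (Finset.card_le_card this).trans (Finset.card_insert_le _ _)
            · rw [add_zero]
              refine div_le_div_of_nonneg_right ?_ (hN j).le
              have : Lx x j \ (R j).erase l ⊆ Lx x j \ R j := by
                intro m
                simp only [Finset.mem_sdiff, Finset.mem_erase]
                rintro ⟨hm, hm'⟩
                refine ⟨hm, fun h => hm' ⟨?_, h⟩⟩
                rintro rfl
                exact hlx hm
              exact_mod_cast Finset.card_le_card this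
          · simp [R', hj]
        have h7 : (0 : ℝ) ≤ if l ∈ Lx x i then 1 / N i else 0 := by
          split_ifs
          · exact (one_div_pos.2 (hN i)).le
          · exact le_rfl
        simp only [hxA, true_and, w]
        rw [← min_add_add_right]
        exact le_min ((min_le_left _ _).trans (by linarith)) ((min_le_right _ _).trans h5)
      · simp only [hxA, false_and, if_false, add_zero, hdead x hx hxA]
        exact min_le_left _ _
    have h8 := hmin R' hR'
    have h9 := Finset.sum_le_sum h4
    have h10 : ∑ x ∈ S, (if x ∈ A ∧ l ∈ Lx x i then 1 / N i else 0) =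
        ((A.filter fun q => l ∈ Lx q i).card : ℝ) * (1 / N i) := by
      rw [← Finset.sum_filter, Finset.sum_const, nsmul_eq_mul]
      congr 3
      ext q
      simp only [Finset.mem_filter, A]
      tauto
    rw [Finset.sum_add_distrib, h10] at h9
    simp only [F] at h8
    have h11 : c i ≤ ((A.filter fun q => l ∈ Lx q i).card : ℝ) * (1 / N i) := by linarith
    rwa [mul_one_div, le_div_iff₀ (hN i)] at h11
  have hl : ∀ x ∈ A, ∃ l : ι → β, ∀ i, l i ∈ Lx x i ∩ R i := fun x hx =>
    Classical.skolem.1 (Finset.mem_filter.1 hx).2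
  -- If every point were dead, the energy would be at least `|S|`, but keeping all lines already
  -- gives less.
  have hne : A.Nonempty := by
    by_contra h
    rw [Finset.not_nonempty_iff_eq_empty] at h
    have h1 : ∑ x ∈ S, w R x = S.card := by
      rw [Finset.sum_congr rfl fun x hx => hdead x hx (by simp [h])]
      simp
    have h2 : 0 ≤ ∑ j, c j * ((R j).card : ℝ) :=
      Finset.sum_nonneg fun j _ => mul_nonneg (hc0 j) (Nat.cast_nonneg _)
    simp only [F, h1] at hFL
    linarith
  have : Nonempty (ι → β) := by
    obtain ⟨x, hx⟩ := hne
    exact (hl x hx).nonempty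
  choose! l hl using hl
  refine ⟨A, Finset.filter_subset _ _, hne, l, fun x hx i => ⟨(Finset.mem_inter.1 (hl x hx i)).1, _,
    Finset.filter_subset _ _, hrich i _ (Finset.mem_inter.1 (hl x hx i)).2, fun q hq => (Finset.mem_filter.1 hq).2⟩⟩

/-! ### From rich lines to the multijoint bound -/

namespace Multijoints

theorem exists_basis_of_directionsSpan {n : ℕ}
    {l : Fin n → AffineSubspace ℝ (EuclideanSpace ℝ (Fin n))} (hl : ∀ i, IsLine (l i))
    (hspan : DirectionsSpan l) :
    ∃ b : Module.Basis (Fin n) ℝ (EuclideanSpace ℝ (Fin n)),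
      ∀ i, ∀ v ∈ (l i).direction, ∃ s : ℝ, v = s • b i := by
  have h : ∀ i, ∃ v : EuclideanSpace ℝ (Fin n), v ∈ (l i).direction ∧
      ∀ u ∈ (l i).direction, ∃ s : ℝ, u = s • v := by
    intro i
    obtain ⟨v, -, hv⟩ := finrank_eq_one_iff'.1 (hl i)
    refine ⟨v, v.2, fun u hu => ?_⟩
    obtain ⟨s, hs⟩ := hv ⟨u, hu⟩
    exact ⟨s, by rw [← Submodule.coe_smul, hs]⟩
  choose v hv hs using h
  have htop : ⊤ ≤ Submodule.span ℝ (Set.range v) := by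
    rw [← hspan]
    refine iSup_le fun i u hu => ?_
    obtain ⟨s, rfl⟩ := hs i u hu
    exact Submodule.smul_mem _ _ (Submodule.subset_span ⟨i, rfl⟩)
  refine ⟨basisOfTopLeSpanOfCardEqFinrank v htop (by simp), fun i u hu => ?_⟩
  obtain ⟨s, hs⟩ := hs i u hu
  exact ⟨s, by simpa using hs⟩

/-- If each point of `A` lies on lines with spanning directions, the `i`-th of which contains at
least `t i` points of `A`, then `A` is large. -/
theorem prod_le_card {n : ℕ} {A : Finset (EuclideanSpace ℝ (Fin n))} (hA : A.Nonempty)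
    {l : EuclideanSpace ℝ (Fin n) → Fin n → AffineSubspace ℝ (EuclideanSpace ℝ (Fin n))}
    (hl : ∀ x ∈ A, ∀ i, IsLine (l x i) ∧ x ∈ l x i) (hspan : ∀ x ∈ A, DirectionsSpan (l x))
    {t : Fin n → ℝ} (ht : ∀ i, 0 < t i)
    (hrich : ∀ x ∈ A, ∀ i, ∃ B ⊆ A, t i ≤ B.card ∧ ∀ q ∈ B, q ∈ l x i) :
    ∏ i, t i ≤ (2 * n) ^ n * A.card := by
  classical
  have hb : ∀ x : EuclideanSpace ℝ (Fin n),
      ∃ b : Module.Basis (Fin n) ℝ (EuclideanSpace ℝ (Fin n)),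
        x ∈ A → ∀ i, ∀ v ∈ (l x i).direction, ∃ s : ℝ, v = s • b i := by
    intro x
    by_cases hx : x ∈ A
    · obtain ⟨b, hb⟩ := exists_basis_of_directionsSpan (fun i => (hl x hx i).1) (hspan x hx)
      exact ⟨b, fun _ => hb⟩
    · exact ⟨(EuclideanSpace.basisFun (Fin n) ℝ).toBasis, fun h => absurd h hx⟩
  choose b hb using hb
  let φ := WithLp.linearEquiv 2 ℝ (Fin n → ℝ)
  let T : (Fin n → ℝ) → (Fin n → ℝ) ≃ᵃ[ℝ] (Fin n → ℝ) := fun x =>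
    (((b (φ.symm x)).map φ).equivFun.symm.toAffineEquiv).trans (AffineEquiv.constVAdd ℝ _ x)
  have hT0 : ∀ x, T x 0 = x := by intro x; simp [T]
  have hTs : ∀ x i s, T (φ x) (Pi.single i s) = φ (x + s • b x i) := by
    intro x i s
    simp [T, Module.Basis.equivFun_symm_apply, Pi.single_apply]
  let A' := A.map φ.toEquiv.toEmbedding
  have hinj : ∀ x i, Function.Injective fun s : ℝ => T x (Pi.single i s) := fun x i =>
    (T x).injective.comp (Pi.single_injective i)
  let S : (Fin n → ℝ) → Fin n → Finset ℝ := fun x i =>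
    A'.preimage (fun s : ℝ => T x (Pi.single i s)) (hinj x i).injOn
  have hS : ∀ x ∈ A, ∀ i, t i ≤ (S (φ x) i).card := by
    intro x hx i
    obtain ⟨B, hBA, hB, hBl⟩ := hrich x hx i
    refine hB.trans ?_
    have : B.map φ.toEquiv.toEmbedding ⊆
        (S (φ x) i).image fun s : ℝ => T (φ x) (Pi.single i s) := by
      intro q hq
      obtain ⟨q, hqB, rfl⟩ := Finset.mem_map.1 hq
      obtain ⟨s, hs⟩ := hb x hx i (q -ᵥ x)
        (AffineSubspace.vsub_mem_direction (hBl q hqB) (hl x hx i).2)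
      have hqs : T (φ x) (Pi.single i s) = φ q := by
        rw [hTs, ← hs, vsub_eq_sub, add_sub_cancel]
      rw [Finset.mem_image]
      refine ⟨s, ?_, hqs⟩
      rw [Finset.mem_preimage, hqs]
      exact Finset.mem_map_of_mem _ (hBA hqB)
    have h := (Finset.card_le_card this).trans Finset.card_image_le
    rw [Finset.card_map] at h
    exact_mod_cast h
  set d := A.card with hd
  have hd0 : (0 : ℝ) < d := by exact_mod_cast hA.card_pos
  have htd : ∀ i, t i ≤ d := by
    intro i
    obtain ⟨x, hx⟩ := hA
    obtain ⟨B, hBA, hB, -⟩ := hrich x hx i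
    exact hB.trans (by exact_mod_cast Finset.card_le_card hBA)
  -- The least natural number with `n d < (β i + 1) t i`; here `n d` bounds the total degree.
  let β : Fin n → ℕ := fun i => ⌊(n * d : ℝ) / t i⌋₊
  have hmain := MvPolynomial.pow_le_card_mul_prod (A := A') (by simpa [A'] using hA) T hT0 S
    (fun x _ i s hs => by simpa only [S, Finset.mem_preimage] using hs) (β := β) (d := d) (by
      intro x hx i
      obtain ⟨x, hxA, rfl⟩ := Finset.mem_map.1 hx
      have h1 : (n * d : ℝ) < (β i + 1) * t i := by
        rw [← div_lt_iff₀ (ht i)]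
        exact Nat.lt_floor_add_one _
      have h2 : (n * d : ℝ) < (β i + 1) * (S (φ x) i).card :=
        h1.trans_le (mul_le_mul_of_nonneg_left (hS x hxA i) (by positivity))
      rw [Fintype.card_fin]
      exact_mod_cast h2)
  rw [Fintype.card_fin, Finset.card_map] at hmain
  -- The choice `d = |A|` gives `t i ≤ d ≤ n d`, which absorbs the `+ 1`.
  have hβ : ∀ i, ((β i : ℝ) + 1) * t i ≤ 2 * n * d := by
    intro i
    have hn : (1 : ℝ) ≤ n := by
      exact_mod_cast Nat.one_le_iff_ne_zero.2 (by rintro rfl; exact i.elim0)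
    have h1 : (β i : ℝ) ≤ (n * d : ℝ) / t i := Nat.floor_le (by have := ht i; positivity)
    rw [le_div_iff₀ (ht i)] at h1
    nlinarith [htd i]
  have hmain' : ((d : ℝ)) ^ n ≤ d * ∏ i, ((β i : ℝ) + 1) := by
    have : (((d + 1) ^ n : ℕ) : ℝ) ≤ ((d * ∏ i, (β i + 1) : ℕ) : ℝ) := by exact_mod_cast hmain
    push_cast at this
    exact (pow_le_pow_left₀ hd0.le (by linarith) n).trans this
  have hprod : (∏ i, ((β i : ℝ) + 1)) * ∏ i, t i ≤ (2 * n * d) ^ n := by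
    rw [← Finset.prod_mul_distrib]
    refine (Finset.prod_le_prod (fun i _ => ?_) fun i _ => hβ i).trans (by simp)
    exact mul_nonneg (by positivity) (ht i).le
  have ht0 : 0 ≤ ∏ i, t i := Finset.prod_nonneg fun i _ => (ht i).le
  have hfin : (d : ℝ) ^ n * ∏ i, t i ≤ (d : ℝ) ^ n * ((2 * n) ^ n * d) :=
    calc (d : ℝ) ^ n * ∏ i, t i ≤ (d * ∏ i, ((β i : ℝ) + 1)) * ∏ i, t i :=
          mul_le_mul_of_nonneg_right hmain' ht0
      _ = d * ((∏ i, ((β i : ℝ) + 1)) * ∏ i, t i) := by ring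
      _ ≤ d * (2 * n * d) ^ n := mul_le_mul_of_nonneg_left hprod hd0.le
      _ = (d : ℝ) ^ n * ((2 * n) ^ n * d) := by rw [mul_pow]; ring
  exact le_of_mul_le_mul_left hfin (by positivity)

/-- The bound for a finite set of multijoints, with `N i` lines of a transversal collection
through each of them. -/
theorem card_sq_mul_le {S : Finset (EuclideanSpace ℝ (Fin 3))}
    {𝔏 : Fin 3 → Finset (AffineSubspace ℝ (EuclideanSpace ℝ (Fin 3)))}
    (hline : ∀ i, ∀ l ∈ 𝔏 i, IsLine l) {N : Fin 3 → ℝ} (hN : ∀ i, 0 < N i)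
    (hS : ∀ x ∈ S, x ∈ richMultijoints N 𝔏) :
    (S.card : ℝ) ^ 2 * ∏ i, N i ≤ 118 ^ 2 * ∏ i, ((𝔏 i).card : ℝ) := by
  classical
  rcases S.eq_empty_or_nonempty with rfl | hne
  · rw [Finset.card_empty, Nat.cast_zero, zero_pow two_ne_zero, zero_mul]
    positivity
  have h : ∀ x : EuclideanSpace ℝ (Fin 3),
      ∃ Lx : Fin 3 → Finset (AffineSubspace ℝ (EuclideanSpace ℝ (Fin 3))),
        x ∈ S → (∀ i, Lx i ⊆ 𝔏 i) ∧ (∀ i, ∀ l ∈ Lx i, x ∈ l) ∧ Transversal Lx ∧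
          ∀ i, N i ≤ ((Lx i).card : ℝ) := by
    intro x
    by_cases hx : x ∈ S
    · obtain ⟨-, Lx, hLx⟩ := hS x hx
      exact ⟨Lx, fun _ => hLx⟩
    · exact ⟨fun _ => ∅, fun h => absurd h hx⟩
  choose Lx hLx using h
  have hs : (0 : ℝ) < S.card := by exact_mod_cast hne.card_pos
  have hL : ∀ i, (0 : ℝ) < (𝔏 i).card := by
    intro i
    obtain ⟨x, hx⟩ := hne
    obtain ⟨h1, -, -, h2⟩ := hLx x hx
    exact ((hN i).trans_le (h2 i)).trans_le (by exact_mod_cast Finset.card_le_card (h1 i))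
  -- With this `c`, keeping all lines costs `3|S|/4`, strictly below `|S|`.
  obtain ⟨A, hAS, hA, l, hl⟩ := Finset.exists_rich_subset (S := S) (Lx := Lx) (L := 𝔏) (N := N)
    (c := fun i => S.card / (4 * (𝔏 i).card)) (fun x hx => (hLx x hx).1) hN
    (fun x hx => (hLx x hx).2.2.2) (fun i => by positivity) (by
      have : ∀ i, (S.card : ℝ) / (4 * (𝔏 i).card) * (𝔏 i).card = S.card / 4 := by
        intro i
        have := (hL i).ne'
        field_simp
      simp only [this, Finset.sum_const, Finset.card_univ, Fintype.card_fin, nsmul_eq_mul]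
      push_cast
      linarith)
  have hprod := prod_le_card hA (l := l)
    (t := fun i => S.card / (4 * (𝔏 i).card) * N i)
    (fun x hx i => ⟨hline i _ ((hLx x (hAS hx)).1 i (hl x hx i).1),
      (hLx x (hAS hx)).2.1 i _ (hl x hx i).1⟩)
    (fun x hx => (hLx x (hAS hx)).2.2.1 _ fun i => (hl x hx i).1)
    (fun i => by have := hL i; have := hN i; positivity)
    (fun x hx i => by
      obtain ⟨B, hBA, hB, hBl⟩ := (hl x hx i).2
      exact ⟨B, hBA, hB, fun q hq => (hLx q (hAS (hBA hq))).2.1 i _ (hBl q hq)⟩)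
  have hcard : (A.card : ℝ) ≤ S.card := by exact_mod_cast Finset.card_le_card hAS
  have h0 := hL 0
  have h1 := hL 1
  have h2 := hL 2
  have hprod' := hprod.trans (mul_le_mul_of_nonneg_left hcard (by positivity))
  simp only [Fin.prod_univ_three] at hprod' ⊢
  have hpos : (0 : ℝ) < (𝔏 0).card * (𝔏 1).card * (𝔏 2).card := by positivity
  have heq : (S.card : ℝ) / (4 * (𝔏 0).card) * N 0 * (S.card / (4 * (𝔏 1).card) * N 1) *
      (S.card / (4 * (𝔏 2).card) * N 2) =
      S.card * ((S.card ^ 2 * (N 0 * N 1 * N 2)) /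
        (64 * ((𝔏 0).card * (𝔏 1).card * (𝔏 2).card))) := by
    field_simp
    ring
  rw [heq, mul_comm _ (S.card : ℝ)] at hprod'
  have h3 := le_of_mul_le_mul_left hprod' hs
  rw [div_le_iff₀ (by positivity)] at h3
  -- The constant is `64 * 6 ^ 3 = 13824 ≤ 118 ^ 2`.
  refine h3.trans ?_
  push_cast
  nlinarith

end Multijoints

theorem Multijoints.card_le {S : Finset (EuclideanSpace ℝ (Fin 3))}
    {𝔏 : Fin 3 → Finset (AffineSubspace ℝ (EuclideanSpace ℝ (Fin 3)))}
    (hline : ∀ i, ∀ l ∈ 𝔏 i, IsLine l) {N : Fin 3 → ℝ} (hN : ∀ i, 0 < N i)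
    (hS : ∀ x ∈ S, x ∈ richMultijoints N 𝔏) :
    (S.card : ℝ) ≤ 118 * ((∏ i, ((𝔏 i).card : ℝ)) ^ (1 / 2 : ℝ) / (∏ i, N i) ^ (1 / 2 : ℝ)) := by
  have hN0 : 0 < ∏ i, N i := Finset.prod_pos fun i _ => hN i
  have h := card_sq_mul_le hline hN hS
  rw [← Real.sqrt_eq_rpow, ← Real.sqrt_eq_rpow, ← mul_div_assoc,
    le_div_iff₀ (Real.sqrt_pos.2 hN0)]
  have h2 := Real.sqrt_le_sqrt h
  rwa [Real.sqrt_mul (by positivity), Real.sqrt_mul (by positivity),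
    Real.sqrt_sq (by positivity), Real.sqrt_sq (by positivity)] at h2

theorem theorem2 :
    ∃ c : ℝ, 0 < c ∧
      ∀ 𝔏 : Fin 3 → Finset (AffineSubspace ℝ (EuclideanSpace ℝ (Fin 3))),
        (∀ i, ∀ l ∈ 𝔏 i, Multijoints.IsLine l) →
        ∀ N₁ N₂ N₃ : ℕ, 0 < N₁ → 0 < N₂ → 0 < N₃ →
          (Multijoints.richMultijoints ![(N₁ : ℝ), (N₂ : ℝ), (N₃ : ℝ)] 𝔏).Finite ∧
          ((Multijoints.richMultijoints ![(N₁ : ℝ), (N₂ : ℝ), (N₃ : ℝ)] 𝔏).ncard : ℝ) ≤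
            c * (((((𝔏 0).card : ℝ) * ((𝔏 1).card : ℝ) * ((𝔏 2).card : ℝ)) ^ (1 / 2 : ℝ)) /
              (((N₁ : ℝ) * (N₂ : ℝ) * (N₃ : ℝ)) ^ (1 / 2 : ℝ))) := by
  refine ⟨118, by norm_num, fun 𝔏 hline N₁ N₂ N₃ h₁ h₂ h₃ => ?_⟩
  have hN : ∀ i, 0 < ![(N₁ : ℝ), (N₂ : ℝ), (N₃ : ℝ)] i := by
    intro i
    fin_cases i <;> simpa
  have key : ∀ S : Finset (EuclideanSpace ℝ (Fin 3)),
      (S : Set (EuclideanSpace ℝ (Fin 3))) ⊆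
        Multijoints.richMultijoints ![(N₁ : ℝ), (N₂ : ℝ), (N₃ : ℝ)] 𝔏 →
      (S.card : ℝ) ≤ 118 * (((((𝔏 0).card : ℝ) * ((𝔏 1).card : ℝ) * ((𝔏 2).card : ℝ)) ^
        (1 / 2 : ℝ)) / (((N₁ : ℝ) * (N₂ : ℝ) * (N₃ : ℝ)) ^ (1 / 2 : ℝ))) := by
    intro S hS
    have := Multijoints.card_le hline hN fun x hx => hS hx
    simpa [Fin.prod_univ_three] using this
  -- The bound is uniform over finite subsets, which rules out an infinite set.
  have hfin : (Multijoints.richMultijoints ![(N₁ : ℝ), (N₂ : ℝ), (N₃ : ℝ)] 𝔏).Finite := by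
    by_contra hinf
    obtain ⟨M, hM⟩ := exists_nat_gt (118 * (((((𝔏 0).card : ℝ) * ((𝔏 1).card : ℝ) *
      ((𝔏 2).card : ℝ)) ^ (1 / 2 : ℝ)) / (((N₁ : ℝ) * (N₂ : ℝ) * (N₃ : ℝ)) ^ (1 / 2 : ℝ))))
    obtain ⟨S, hS, rfl⟩ := Set.Infinite.exists_subset_card_eq hinf M
    exact absurd (key S hS) (not_le.2 hM)
  refine ⟨hfin, ?_⟩
  rw [Set.ncard_eq_toFinset_card _ hfin]
  exact key _ (by simp)
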